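/- **Setting.** Let the local physical space be $\mathbb{C}^d$, $d\ge 1$, with basis vectors of parity $|n|\in\{0,1\}$, and let the auxiliary space be $\mathbb{C}^D$ with basis vectors of parity $|\alpha|\in\{0,1\}$ and diagonal parity operator $Z|\alpha)=(-1)^{|\alpha|}|\alpha)$. A tensor $\mathcal U$ is a family of $D\times D$ complex matrices $U^{n,m}$, $0\le n,m<d$; it is *even* if $ZU^{n,m}=(-1)^{|n|+|m|}U^{n,m}Z$. On a chain of $N$ sites with ordered basis $(a_1^\dagger)^{t_1}\cdots(a_N^\dagger)^{t_N}|\Omega\rangle$, let $f_j^{n,m}$ be the operator that sends this vector to $\delta_{m,t_j}(-1)^{(|n|+|m|)\sum_{l<j}|t_l|}$ times the same vector with $t_j$ replaced by $n$. For a $D\times D$ matrix $S$ put $$U^{(N)}=\sum_{n_1,\dots,n_N,\,m_1,\dots,m_N}\operatorname{tr}\left(S\,U^{n_1,m_1}\cdots U^{n_N,m_N}\right)f_1^{n_1,m_1}\cdots f_N^{n_N,m_N}.$$ An even tensor $\mathcal U$ generates, with antiperiodic boundary conditions, * a *type I* fMPU if, for some $\alpha\in\mathbb{R}$ and $S=e^{i\alpha}\mathbb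 1$, the operator $U^{(N)}$ is unitary for all $N\ge1$; * a *type II* fMPU if the auxiliary space is $\mathbb{C}^2\otimes\mathbb{C}^{D'}$ with $Z=\sigma^z\otimes\mathbb 1$, $U^{n,m}=(\sigma^x)^{|n|+|m|}\otimes M^{n,m}$ for some matrices $M^{n,m}$ (exponent read mod 2; up to a basis identification and a gauge transformation $U^{n,m}\mapsto YU^{n,m}Y^{-1}$ with $Y$ invertible and $[Y,Z]=0$), and, for some $\alpha\in\mathbb{R}$ and $S=\frac{e^{i\alpha}}{\sqrt2}\mathbb 1$, the operator $U^{(N)}$ is unitary for all $N\ge1$. For $k\ge1$ the blocked tensor $\mathcal U_k$ has physical labels $n=(n_1,\dots,n_k)$ with $|n|=\sum_i|n_i|$ mod 2, the same auxiliary space, and $$U_k^{n,m}=(-1)^{\sum_{i<j}|m_i|(|n_j|+|m_j|)}\,U^{n_1,m_1}\cdots U^{n_k,m_k}.$$ For an even tensor $\mathcal U$ define on $\mathbb{C}^D\otimes\mathbb{C}^D$ the matrices $$\mathbb U^{k,i}_{(\alpha,\gamma),(\beta,\delta)}=\sum_j(-1)^{|\beta|(|k|+|i|)}\,\overline{U^{j,k}_{\alpha,\beta}}\,U^{j,i}_{\gamma,\delta},\qquad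 E_{\mathcal U}=\frac1d\sum_i\mathbb U^{i,i}.$$ An even tensor $\mathcal U$ is *simple* (in the fermionic sense) if for all physical labels $$E_{\mathcal U}\,\mathbb U^{k,i}E_{\mathcal U}=\delta_{k,i}E_{\mathcal U},\qquad \mathbb U^{k,i}\,\mathbb U^{k',i'}=\mathbb U^{k,i}E_{\mathcal U}\,\mathbb U^{k',i'},\qquad E_{\mathcal U}^2=E_{\mathcal U}$$ (for $\mathcal U_k$, the dimension $d$ in $E$ is replaced by $d^k$). **Proposition.** If $\mathcal U$ generates a type I or a type II fMPU with antiperiodic boundary conditions, then there exists an integer $k$ with $1\le k\le D^4$ such that the blocked tensor $\mathcal U_k$ is simple in the fermionic sense. -/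

import Mathlib

open scoped Kronecker

noncomputable section

namespace FermionicMPU

variable {ι χ : Type*}

/-- The sign `(-1)^a` of a parity `a`. -/
def sgn (a : ZMod 2) : ℂ := (-1) ^ a.val

/-- The diagonal parity operator of a graded space with basis indexed by `χ`, in which the
basis vector with label `a` has parity `q a` (even `0`, odd `1`). -/
def parityOp [DecidableEq χ] (q : χ → ZMod 2) : Matrix χ χ ℂ :=
  Matrix.diagonal fun a => sgn (q a)

/-- The local fermionic operator `f_j^{n,m}` of a chain of `N` sites, as a matrix in the ordered
occupation basis `(a_1†)^{t 1} ⋯ (a_N†)^{t N} |Ω⟩`. It anticommutes or commutes past the factors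
on the sites before `j` with the sign `(-1)^{(|n|+|m|)|t l|}`, and then replaces
`(a_j†)^{t j}` by `δ_{m, t j} (a_j†)^n`. -/
def siteOp [DecidableEq ι] (p : ι → ZMod 2) {N : ℕ} (j : Fin N) (n m : ι) :
    Matrix (Fin N → ι) (Fin N → ι) ℂ :=
  Matrix.of fun s t =>
    if t j = m ∧ s = Function.update t j n then
      sgn ((p n + p m) * ∑ l ∈ Finset.Iio j, p (t l))
    else 0

/-- The fermionic operator
`U^{(N)} = ∑ tr (S U^{n_1,m_1} ⋯ U^{n_N,m_N}) f_1^{n_1,m_1} ⋯ f_N^{n_N,m_N}`. -/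
def chainOp [Fintype ι] [DecidableEq ι] [Fintype χ] [DecidableEq χ] (p : ι → ZMod 2)
    (S : Matrix χ χ ℂ) (U : ι → ι → Matrix χ χ ℂ) (N : ℕ) :
    Matrix (Fin N → ι) (Fin N → ι) ℂ :=
  ∑ n : Fin N → ι, ∑ m : Fin N → ι,
    (S * (List.ofFn fun j => U (n j) (m j)).prod).trace •
      (List.ofFn fun j => siteOp p j (n j) (m j)).prod

/-- Even local tensors: `Z U^{n,m} = (-1)^{|n|+|m|} U^{n,m} Z`. -/
def IsEven [Fintype χ] [DecidableEq χ] (p : ι → ZMod 2) (q : χ → ZMod 2)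
    (U : ι → ι → Matrix χ χ ℂ) : Prop :=
  ∀ n m, parityOp q * U n m = sgn (p n + p m) • (U n m * parityOp q)

/-- An even tensor `U` with boundary operator `S` generates a generalized fermionic matrix product
unitary with antiperiodic boundary conditions: `S` is even, commutes with the local matrices, and
the operators `U^{(N)}`, `N ≥ 1`, are unitary. -/
def GeneratesAPUnitary [Fintype ι] [DecidableEq ι] [Fintype χ] [DecidableEq χ] (p : ι → ZMod 2)
    (q : χ → ZMod 2) (S : Matrix χ χ ℂ) (U : ι → ι → Matrix χ χ ℂ) : Prop :=
  IsEven p q U ∧ parityOp q * S = S * parityOp q ∧ (∀ n m, S * U n m = U n m * S) ∧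
    ∀ N : ℕ, 1 ≤ N → chainOp p S U N ∈ Matrix.unitaryGroup (Fin N → ι) ℂ

/-- `U` generates a type I fMPU with antiperiodic boundary conditions: `S = e^{iα} 1`. -/
def GeneratesTypeI [Fintype ι] [DecidableEq ι] [Fintype χ] [DecidableEq χ] (p : ι → ZMod 2)
    (q : χ → ZMod 2) (U : ι → ι → Matrix χ χ ℂ) : Prop :=
  ∃ α : ℝ, GeneratesAPUnitary p q (Complex.exp (α * Complex.I) • (1 : Matrix χ χ ℂ)) U

/-- The Pauli matrix `σ^x`. -/
def pauliX : Matrix (Fin 2) (Fin 2) ℂ := !![0, 1; 1, 0]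

/-- The Pauli matrix `σ^z`. -/
def pauliZ : Matrix (Fin 2) (Fin 2) ℂ := !![1, 0; 0, -1]

/-- After identifying the auxiliary space with `ℂ² ⊗ ℂ^{D'}`, the parity operator is `σ^z ⊗ 1` and,
up to an even gauge transformation `Y`, `U^{n,m} = (σ^x)^{|n|+|m|} ⊗ M^{n,m}` with arbitrary
matrices `M^{n,m}`. -/
def HasTypeIIForm [Fintype χ] [DecidableEq χ] (p : ι → ZMod 2) (q : χ → ZMod 2)
    (U : ι → ι → Matrix χ χ ℂ) : Prop :=
  ∃ (D' : ℕ) (e : χ ≃ Fin 2 × Fin D') (M : ι → ι → Matrix (Fin D') (Fin D') ℂ)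
    (Y : Matrix χ χ ℂ),
    parityOp q = (pauliZ ⊗ₖ (1 : Matrix (Fin D') (Fin D') ℂ)).submatrix e e ∧
    IsUnit Y ∧ parityOp q * Y = Y * parityOp q ∧
    ∀ n m, U n m = Y * ((pauliX ^ (p n + p m).val) ⊗ₖ M n m).submatrix e e * Y⁻¹

/-- `U` generates a type II fMPU with antiperiodic boundary conditions: `U` has the form
`(σ^x)^{|n|+|m|} ⊗ M^{n,m}`, and `S = (e^{iα} / √2) 1`. -/
def GeneratesTypeII [Fintype ι] [DecidableEq ι] [Fintype χ] [DecidableEq χ] (p : ι → ZMod 2)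
    (q : χ → ZMod 2) (U : ι → ι → Matrix χ χ ℂ) : Prop :=
  HasTypeIIForm p q U ∧ ∃ α : ℝ, GeneratesAPUnitary p q
    ((Complex.exp (α * Complex.I) / (Real.sqrt 2 : ℂ)) • (1 : Matrix χ χ ℂ)) U

/-- The parity of the basis label of a block of `k` sites. -/
def blockParity (p : ι → ZMod 2) (k : ℕ) (n : Fin k → ι) : ZMod 2 := ∑ i, p (n i)

/-- The fermionic blocked tensor `U_k`. The sign comes from
`f^{(n_1…n_k),(m_1…m_k)} = (-1)^{∑_{i<j} |m_i|(|n_j|+|m_j|)} f_1^{n_1,m_1} ⋯ f_k^{n_k,m_k}`. -/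
def blockTensor [Fintype χ] [DecidableEq χ] (p : ι → ZMod 2) (U : ι → ι → Matrix χ χ ℂ) (k : ℕ)
    (n m : Fin k → ι) : Matrix χ χ ℂ :=
  sgn (∑ i, ∑ j ∈ Finset.Ioi i, p (m i) * (p (n j) + p (m j))) •
    (List.ofFn fun i => U (n i) (m i)).prod

/-- The local tensor of `U^{(N)†} U^{(N)}`:
`𝕌^{k,i}_{(α,γ),(β,δ)} = ∑_j (-1)^{|β|(|k|+|i|)} conj (U^{j,k}_{α,β}) U^{j,i}_{γ,δ}`. -/
def stacked [Fintype ι] (p : ι → ZMod 2) (q : χ → ZMod 2) (U : ι → ι → Matrix χ χ ℂ)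
    (k i : ι) : Matrix (χ × χ) (χ × χ) ℂ :=
  Matrix.of fun a b =>
    ∑ j, sgn (q b.1 * (p k + p i)) * star (U j k a.1 b.1) * U j i a.2 b.2

/-- The transfer matrix `E_{(α,γ),(β,δ)} = (1/d) ∑_{i,j} conj (U^{j,i}_{α,β}) U^{j,i}_{γ,δ}`. -/
def transfer [Fintype ι] (U : ι → ι → Matrix χ χ ℂ) : Matrix (χ × χ) (χ × χ) ℂ :=
  Matrix.of fun a b =>
    (1 / (Fintype.card ι : ℂ)) * ∑ i, ∑ j, star (U j i a.1 b.1) * U j i a.2 b.2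

/-- Fermionic simpleness of an even tensor: `E 𝕌^{k,i} E = δ_{k,i} E`,
`𝕌^{k,i} 𝕌^{k',i'} = 𝕌^{k,i} E 𝕌^{k',i'}` and `E² = E`. -/
def IsSimple [Fintype ι] [DecidableEq ι] [Fintype χ] [DecidableEq χ] (p : ι → ZMod 2)
    (q : χ → ZMod 2) (U : ι → ι → Matrix χ χ ℂ) : Prop :=
  IsEven p q U ∧
  (∀ k i, transfer U * stacked p q U k i * transfer U = if k = i then transfer U else 0) ∧
  (∀ k i k' i', stacked p q U k i * stacked p q U k' i' =
    stacked p q U k i * transfer U * stacked p q U k' i') ∧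
  transfer U * transfer U = transfer U

end FermionicMPU

end

/-! Unitarity of $U^{(N)}$ for all $N$ says that traces of words in the matrices $\mathbb U^{k,i}$
are known. In type I a word has trace $\prod_a\delta_{k_a,i_a}$, so the trace is multiplicative on
the non-unital algebra $\mathcal A$ that they generate. Its kernel $R$ is then an algebra of
traceless, hence nilpotent, matrices, and by Engel's theorem any product of $D^2$ elements of $R$
vanishes (`list_prod_eq_zero_of_trace_eq_zero`).

Since $E$ has trace 1, it equals a rank-one idempotent $P\in\mathcal A$ plus an element of $R$
annihilated by $P$ on both sides, so $E^{D^2}=P$. Rank one gives $PaP=\operatorname{tr}(Pa)P$, the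
first simpleness identity. Expanding each letter as $a=\rho(a)+\operatorname{tr}(a)P$ with
$\rho(a)\in R$ gives the second for words of length $D^2$ (`list_prod_mul_list_prod`). Blocking
turns stacked matrices into such words up to harmless signs.

In type II the traces are doubled. An odd $X$ with $X^2=1$ commutes with all $U^{n,m}$, and the
projections $\frac12(1\pm 1\otimes X)$ commute with every $\mathbb U^{k,i}$. A further symmetry
anticommuting with $1\otimes X$ makes each half carry half the trace, so the type I argument applies
to each half and the results add up (`IsWordSimple.of_add`). -/

noncomputable section

namespace FermionicMPU

/-! ### Traceless algebras of endomorphisms and nilpotency -/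

section TraceNilpotent

open Polynomial

attribute [local instance] LieRing.ofAssociativeRing

variable {V : Type*} [AddCommGroup V] [Module ℂ V]

/-- The factor `X` excludes the constant term, where the trace is `dim V` instead of `c ^ 0`. -/
lemma trace_aeval_eq_eval (f : Module.End ℂ V) {c : ℂ}
    (h : ∀ m : ℕ, 1 ≤ m → LinearMap.trace ℂ V (f ^ m) = c ^ m) (g : ℂ[X]) :
    LinearMap.trace ℂ V (aeval f (X * g)) = (X * g).eval c := by
  induction g using Polynomial.induction_on' with
  | add p q hp hq => simp only [mul_add, map_add, eval_add, hp, hq]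
  | monomial n a =>
    have : (X * monomial n a : ℂ[X]) = monomial (n + 1) a := by
      rw [X_mul_monomial]
    rw [this, aeval_monomial, eval_monomial, ← Algebra.smul_def, map_smul, h _ (by omega),
      smul_eq_mul]

variable [FiniteDimensional ℂ V]

/-- The projection onto the part where `f` is invertible is a polynomial in `f` without constant
term. It therefore has trace zero, and in characteristic zero it vanishes. -/
lemma isNilpotent_of_trace_pow_eq_zero (f : Module.End ℂ V)
    (h : ∀ m : ℕ, 1 ≤ m → LinearMap.trace ℂ V (f ^ m) = 0) : IsNilpotent f := by
  have hf : aeval f f.charpoly = 0 := f.aeval_self_charpoly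
  obtain ⟨g, hg, hdvd⟩ := exists_eq_pow_rootMultiplicity_mul_and_not_dvd f.charpoly
    f.charpoly_monic.ne_zero 0
  set m := rootMultiplicity 0 f.charpoly
  rw [C_0, sub_zero] at hg hdvd
  -- The exponent `m + 1` leaves a factor `X` to split off even when `m = 0`.
  have hcop : IsCoprime (X ^ (m + 1)) g :=
    IsCoprime.pow_left ((irreducible_X.coprime_iff_not_dvd).2 hdvd)
  obtain ⟨u, v, huv⟩ := hcop
  have hzero : aeval f (X ^ (m + 1) * g) = 0 := by
    rw [pow_succ', mul_assoc, ← hg, map_mul, hf, mul_zero]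
  have hsum : aeval f (u * X ^ (m + 1)) + aeval f (v * g) = 1 := by
    rw [← map_add, huv, map_one]
  have hprod : aeval f (u * X ^ (m + 1)) * aeval f (v * g) = 0 := by
    rw [← map_mul, show u * X ^ (m + 1) * (v * g) = u * v * (X ^ (m + 1) * g) by ring, map_mul,
      hzero, mul_zero]
  have hidem : IsIdempotentElem (aeval f (u * X ^ (m + 1))) := by
    have := congrArg (aeval f (u * X ^ (m + 1)) * ·) hsum
    simp only [mul_add, hprod, add_zero, mul_one] at this
    exact this
  have htr : LinearMap.trace ℂ V (aeval f (u * X ^ (m + 1))) = 0 := by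
    rw [show u * X ^ (m + 1) = X * (u * X ^ m) by ring,
      trace_aeval_eq_eval f (c := 0) (fun k hk => by rw [h k hk, zero_pow (by omega)])]
    simp
  have he := LinearMap.IsIdempotentElem.eq_zero_of_trace_eq_zero hidem htr
  rw [he, zero_add] at hsum
  refine ⟨m + 1, ?_⟩
  have : aeval f (X ^ (m + 1) : ℂ[X]) * aeval f (v * g) = 0 := by
    rw [← map_mul, show X ^ (m + 1) * (v * g) = v * (X ^ (m + 1) * g) by ring, map_mul,
      hzero, mul_zero]
  rwa [hsum, mul_one, map_pow, aeval_X] at this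

/-- The trace of a projection is its rank, so the range of `P` is a line. -/
lemma mul_mul_eq_trace_smul {P : Module.End ℂ V} (hP : IsIdempotentElem P)
    (htr : LinearMap.trace ℂ V P = 1) (f : Module.End ℂ V) :
    P * f * P = LinearMap.trace ℂ V (P * f) • P := by
  have hproj : LinearMap.IsProj (LinearMap.range P) P := LinearMap.IsIdempotentElem.isProj_range P hP
  have hrank : Module.finrank ℂ (LinearMap.range P) = 1 := by
    have := hproj.trace
    rw [htr] at this
    exact_mod_cast this.symm
  obtain ⟨v, hv, hspan⟩ := finrank_eq_one_iff'.1 hrank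
  obtain ⟨v, hvmem⟩ := v
  have key : ∃ c : ℂ, P * f * P = c • P := by
    obtain ⟨c, hc⟩ := hspan ⟨P (f v), LinearMap.mem_range_self _ _⟩
    refine ⟨c, ?_⟩
    ext x
    obtain ⟨a, ha⟩ := hspan ⟨P x, LinearMap.mem_range_self _ _⟩
    simp only [Subtype.ext_iff, Submodule.coe_smul] at ha hc
    simp only [Module.End.mul_apply, LinearMap.smul_apply, ← ha, map_smul, ← hc]
    rw [smul_comm]
  obtain ⟨c, hc⟩ := key
  have h2 : LinearMap.trace ℂ V (P * f) = c := by
    have := congrArg (LinearMap.trace ℂ V) hc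
    rwa [LinearMap.trace_mul_comm, ← mul_assoc, hP.eq, map_smul, htr, smul_eq_mul, mul_one] at this
  rw [hc, h2]

/-- Powers of elements of `W` stay in `W`, so all its elements are nilpotent and Engel's theorem
applies to `W` with the commutator bracket. The lower central series of `V` drops in dimension until
it is zero, and a product of `j` elements maps `V` into its `j`-th term. -/
lemma list_prod_eq_zero_of_trace_eq_zero (W : NonUnitalSubalgebra ℂ (Module.End ℂ V))
    (hW : ∀ a ∈ W, LinearMap.trace ℂ V a = 0) (l : List (Module.End ℂ V)) (hl : ∀ a ∈ l, a ∈ W)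
    (hlen : Module.finrank ℂ V ≤ l.length) : l.prod = 0 := by
  let L : LieSubalgebra ℂ (Module.End ℂ V) :=
    { W.toSubmodule with
      lie_mem' := fun {x y} hx hy => by
        rw [Ring.lie_def]
        exact W.toSubmodule.sub_mem (W.mul_mem hx hy) (W.mul_mem hy hx) }
  have hLW : ∀ x : L, (x : Module.End ℂ V) ∈ W := fun x => x.2
  have hnil : LieModule.IsNilpotent L V := by
    rw [LieModule.isNilpotent_iff_forall (R := ℂ)]
    intro x
    refine isNilpotent_of_trace_pow_eq_zero _ fun m hm => ?_
    have : LieModule.toEnd ℂ L V x = (x : Module.End ℂ V) := rfl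
    rw [this]
    apply hW
    clear this
    induction m, hm using Nat.le_induction with
    | base => simp [hLW x]
    | succ k _ ih => rw [pow_succ]; exact W.mul_mem ih (hLW x)
  obtain ⟨k, hk⟩ := hnil.nilpotent (R := ℂ)
  let F : ℕ → LieSubmodule ℂ L V := fun j => LieModule.lowerCentralSeries ℂ L V j
  have hsucc : ∀ j, F (j + 1) = ⁅(⊤ : LieIdeal ℂ L), F j⁆ := fun j =>
    LieModule.lowerCentralSeries_succ ..
  have hanti : Antitone F := LieModule.antitone_lowerCentralSeries ℂ L V
  have hrank : ∀ j, F j = ⊥ ∨ Module.finrank ℂ (F j) + j ≤ Module.finrank ℂ V := by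
    intro j
    induction j with
    | zero => right; exact (add_zero _).trans_le (Submodule.finrank_le _)
    | succ j ih =>
      rcases ih with ih | ih
      · left; rw [eq_bot_iff, ← ih]; exact hanti (Nat.le_succ j)
      · by_cases heq : F (j + 1) = F j
        · left
          -- A series that stalls is constant from there on, yet it reaches `⊥` eventually.
          have hst : ∀ i, F (j + i) = F j := by
            intro i
            induction i with
            | zero => rfl
            | succ i ihi => rw [← add_assoc, hsucc, ihi, ← hsucc, heq]
          rw [heq, ← hst k, eq_bot_iff, ← hk]
          exact hanti (Nat.le_add_left k j)
        · right
          have hlt : (F (j + 1)).toSubmodule < (F j).toSubmodule :=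
            lt_of_le_of_ne (hanti (Nat.le_succ j))
              (fun h => heq (LieSubmodule.toSubmodule_injective h))
          have := Submodule.finrank_lt_finrank_of_lt hlt
          have h1 : Module.finrank ℂ (F (j + 1)) < Module.finrank ℂ (F j) := this
          omega
  have hmem : ∀ l : List (Module.End ℂ V), (∀ a ∈ l, a ∈ W) → ∀ v, l.prod v ∈ F l.length := by
    intro l
    induction l with
    | nil => intro _ v; exact LieSubmodule.mem_top v
    | cons a l ih =>
      intro hl v
      rw [List.length_cons, hsucc, List.prod_cons, Module.End.mul_apply]
      exact LieSubmodule.lie_mem_lie (x := (⟨a, hl a (by simp)⟩ : L)) (LieSubmodule.mem_top _)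
        (ih (fun b hb => hl b (by simp [hb])) v)
  have hbot : F l.length = ⊥ := by
    rcases hrank l.length with h | h
    · exact h
    · have h0 : Module.finrank ℂ (F l.length) = 0 := by omega
      exact LieSubmodule.toSubmodule_injective (Submodule.finrank_eq_zero.1 h0)
  ext v
  have := hmem l hl v
  rw [hbot] at this
  simpa using this

end TraceNilpotent

/-! ### Algebras on which the trace is multiplicative -/

section TraceCharacter

open Polynomial

variable {V : Type*} [AddCommGroup V] [Module ℂ V]

lemma aeval_X_mul_mem (𝒜 : NonUnitalSubalgebra ℂ (Module.End ℂ V)) {a : Module.End ℂ V}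
    (ha : a ∈ 𝒜) (g : ℂ[X]) : aeval a (X * g) ∈ 𝒜 := by
  have hpow : ∀ n : ℕ, a ^ (n + 1) ∈ 𝒜 := by
    intro n
    induction n with
    | zero => simpa using ha
    | succ n ih => rw [pow_succ]; exact 𝒜.mul_mem ih ha
  induction g using Polynomial.induction_on' with
  | add p q hp hq => rw [mul_add, map_add]; exact 𝒜.add_mem hp hq
  | monomial n c =>
    rw [X_mul_monomial, aeval_monomial, ← Algebra.smul_def]
    exact 𝒜.smul_mem c (hpow n)

/-- The kernel of the trace on an algebra on which the trace is multiplicative. -/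
def traceKernel (𝒜 : NonUnitalSubalgebra ℂ (Module.End ℂ V))
    (hmul : ∀ a ∈ 𝒜, ∀ b ∈ 𝒜, LinearMap.trace ℂ V (a * b) =
      LinearMap.trace ℂ V a * LinearMap.trace ℂ V b) :
    NonUnitalSubalgebra ℂ (Module.End ℂ V) where
  carrier := {a | a ∈ 𝒜 ∧ LinearMap.trace ℂ V a = 0}
  add_mem' ha hb := ⟨𝒜.add_mem ha.1 hb.1, by rw [map_add, ha.2, hb.2, add_zero]⟩
  zero_mem' := ⟨𝒜.zero_mem, map_zero _⟩
  mul_mem' ha hb := ⟨𝒜.mul_mem ha.1 hb.1, by rw [hmul _ ha.1 _ hb.1, ha.2, zero_mul]⟩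
  smul_mem' c _ ha := ⟨𝒜.smul_mem c ha.1, by rw [map_smul, ha.2, smul_zero]⟩

lemma mem_traceKernel {𝒜 : NonUnitalSubalgebra ℂ (Module.End ℂ V)}
    {hmul : ∀ a ∈ 𝒜, ∀ b ∈ 𝒜, LinearMap.trace ℂ V (a * b) =
      LinearMap.trace ℂ V a * LinearMap.trace ℂ V b} {a : Module.End ℂ V} :
    a ∈ traceKernel 𝒜 hmul ↔ a ∈ 𝒜 ∧ LinearMap.trace ℂ V a = 0 :=
  Iff.rfl

variable {𝒜 : NonUnitalSubalgebra ℂ (Module.End ℂ V)}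
  (hmul : ∀ a ∈ 𝒜, ∀ b ∈ 𝒜, LinearMap.trace ℂ V (a * b) =
    LinearMap.trace ℂ V a * LinearMap.trace ℂ V b)

include hmul

lemma trace_pow_of_mem {a : Module.End ℂ V} (ha : a ∈ 𝒜) (m : ℕ) (hm : 1 ≤ m) :
    a ^ m ∈ 𝒜 ∧ LinearMap.trace ℂ V (a ^ m) = LinearMap.trace ℂ V a ^ m := by
  induction m, hm using Nat.le_induction with
  | base => simpa using ha
  | succ k _ ih => exact ⟨by rw [pow_succ]; exact 𝒜.mul_mem ih.1 ha, by
      rw [pow_succ, hmul _ ih.1 _ ha, ih.2, pow_succ]⟩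

variable [FiniteDimensional ℂ V]

/-- `E - E * E` lies in the trace kernel and is nilpotent, so `E` lifts to an idempotent polynomial
in `E`. Its trace is the value of that polynomial at 1. -/
lemma exists_isIdempotentElem_of_trace_eq_one {E : Module.End ℂ V} (hE : E ∈ 𝒜)
    (htr : LinearMap.trace ℂ V E = 1) :
    ∃ P ∈ 𝒜, IsIdempotentElem P ∧ LinearMap.trace ℂ V P = 1 ∧ E * P = P ∧ P * E = P := by
  have hN : E - E * E ∈ traceKernel 𝒜 hmul := mem_traceKernel.2
    ⟨𝒜.toSubmodule.sub_mem hE (𝒜.mul_mem hE hE), by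
      rw [map_sub, hmul E hE E hE, htr, mul_one, sub_self]⟩
  obtain ⟨k, hk⟩ := isNilpotent_of_trace_pow_eq_zero (E - E * E) fun m hm => by
    rw [(trace_pow_of_mem hmul (mem_traceKernel.1 hN).1 m hm).2,
      (mem_traceKernel.1 hN).2, zero_pow (by omega)]
  -- The lifting polynomial is divisible by `X ^ (k + 1)` and its complement by `(1 - X) ^ (k + 1)`;
  -- their product vanishes at `E`.
  obtain ⟨h, hh⟩ : (X : ℂ[X]) ^ (k + 1) ∣ 1 - (1 - X ^ (k + 1)) ^ (k + 1) := by
    have := sub_dvd_pow_sub_pow (1 : ℂ[X]) (1 - X ^ (k + 1)) (k + 1)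
    rwa [one_pow, sub_sub_cancel] at this
  obtain ⟨r, hr⟩ : (1 - X : ℂ[X]) ∣ 1 - X ^ (k + 1) := by
    simpa only [one_pow] using sub_dvd_pow_sub_pow (1 : ℂ[X]) X (k + 1)
  have hX : X ^ (k + 1) * h = X * (X ^ k * h) := by ring
  have hPm : aeval E (X ^ (k + 1) * h) ∈ 𝒜 := by rw [hX]; exact aeval_X_mul_mem 𝒜 hE _
  have hPi : IsIdempotentElem (aeval E (X ^ (k + 1) * h)) := by
    have hq : X ^ (k + 1) * h - X ^ (k + 1) * h * (X ^ (k + 1) * h)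
        = (X - X * X) ^ k * ((X - X * X) * (r ^ (k + 1) * h)) := by
      have : 1 - X ^ (k + 1) * h = ((1 - X) * r) ^ (k + 1) := by rw [← hr, ← hh]; ring
      calc _ = X ^ (k + 1) * h * (1 - X ^ (k + 1) * h) := by ring
        _ = _ := by
          rw [this, show (X - X * X : ℂ[X]) = X * (1 - X) by ring, mul_pow, mul_pow]; ring
    have := congrArg (aeval E) hq
    have hz : aeval E ((X - X * X : ℂ[X]) ^ k) = 0 := by
      rw [map_pow, map_sub, map_mul, aeval_X, hk]
    rw [map_mul _ ((X - X * X : ℂ[X]) ^ k), hz, zero_mul, map_sub,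
      map_mul _ (X ^ (k + 1) * h), sub_eq_zero] at this
    exact this.symm
  have hPt : LinearMap.trace ℂ V (aeval E (X ^ (k + 1) * h)) = 1 := by
    rw [hX, trace_aeval_eq_eval E (c := 1) (fun m hm => by
      rw [(trace_pow_of_mem hmul hE m hm).2, htr]), ← hX, ← hh]
    simp
  have hcomm : E * aeval E (X ^ (k + 1) * h) = aeval E (X ^ (k + 1) * h) * E := by
    have := congrArg (aeval E) (mul_comm (X : ℂ[X]) (X ^ (k + 1) * h))
    rwa [map_mul, map_mul _ (X ^ (k + 1) * h), aeval_X] at this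
  generalize aeval E (X ^ (k + 1) * h) = P at *
  have h1 := mul_mul_eq_trace_smul hPi hPt E
  rw [hmul _ hPm _ hE, hPt, htr, mul_one, one_smul, mul_assoc, hcomm, ← mul_assoc, hPi.eq] at h1
  exact ⟨P, hPm, hPi, hPt, hcomm.trans h1, h1⟩

/-- In `E = P + (E - P)` the two summands annihilate each other, and the second lies in the trace
kernel, so its `n`-th power vanishes. -/
lemma isIdempotentElem_pow_finrank {E : Module.End ℂ V} (hE : E ∈ 𝒜)
    (htr : LinearMap.trace ℂ V E = 1) {n : ℕ} (hn : Module.finrank ℂ V ≤ n) (hn1 : 1 ≤ n) :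
    E ^ n ∈ 𝒜 ∧ IsIdempotentElem (E ^ n) ∧ LinearMap.trace ℂ V (E ^ n) = 1 := by
  obtain ⟨P, hPm, hPi, hPt, hEP, hPE⟩ := exists_isIdempotentElem_of_trace_eq_one hmul hE htr
  have hM : E - P ∈ traceKernel 𝒜 hmul := mem_traceKernel.2 ⟨𝒜.toSubmodule.sub_mem hE hPm, by
    rw [map_sub, htr, hPt, sub_self]⟩
  have hnil : (E - P) ^ n = 0 := by
    rw [← List.prod_replicate]
    exact list_prod_eq_zero_of_trace_eq_zero _ (fun a ha => (mem_traceKernel.1 ha).2) _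
      (fun a ha => List.eq_of_mem_replicate ha ▸ hM) (by simpa using hn)
  have hpow : ∀ m : ℕ, 1 ≤ m → E ^ m = P + (E - P) ^ m := by
    intro m hm
    induction m, hm using Nat.le_induction with
    | base => simp
    | succ k hk ih =>
      have h0 : P * (E - P) = 0 := by rw [mul_sub, hPE, hPi.eq, sub_self]
      have h1 : (E - P) ^ k * P = 0 := by
        obtain ⟨j, rfl⟩ := Nat.exists_eq_add_of_le' hk
        rw [pow_succ, mul_assoc, sub_mul, hEP, hPi.eq, sub_self, mul_zero]
      rw [pow_succ, ih, add_mul, hPE, pow_succ, mul_sub, h1, sub_zero]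
  have : E ^ n = P := by rw [hpow n hn1, hnil, add_zero]
  rw [this]
  exact ⟨hPm, hPi, hPt⟩

/-- The claim is `l.prod * (1 - P) * l'.prod = 0`. Replacing every letter by its component `ρ a` in
the kernel `R` gives zero by length; the `P` components drop out because `P * r * P = 0` for `r ∈
R`. -/
lemma list_prod_mul_list_prod {P : Module.End ℂ V} (hPm : P ∈ 𝒜) (hPi : IsIdempotentElem P)
    (hPt : LinearMap.trace ℂ V P = 1) (l l' : List (Module.End ℂ V)) (hl : ∀ a ∈ l, a ∈ 𝒜)
    (hl' : ∀ a ∈ l', a ∈ 𝒜) (hlen : Module.finrank ℂ V ≤ l.length)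
    (hlen' : Module.finrank ℂ V ≤ l'.length) :
    l.prod * l'.prod = l.prod * P * l'.prod := by
  set R := traceKernel 𝒜 hmul
  let ρ : Module.End ℂ V → Module.End ℂ V := fun a => a - LinearMap.trace ℂ V a • P
  have hρ : ∀ a ∈ 𝒜, ρ a ∈ R := fun a ha => mem_traceKernel.2
    ⟨𝒜.toSubmodule.sub_mem ha (𝒜.smul_mem _ hPm), by
      simp only [ρ, map_sub, map_smul, hPt, smul_eq_mul, mul_one, sub_self]⟩
  have hsplit : ∀ a, a = ρ a + LinearMap.trace ℂ V a • P := fun a => (sub_add_cancel _ _).symm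
  have hPRP : ∀ r ∈ R, P * r * P = 0 := fun r hr => by
    rw [mul_mul_eq_trace_smul hPi hPt, hmul _ hPm _ (mem_traceKernel.1 hr).1,
      (mem_traceKernel.1 hr).2, mul_zero, zero_smul]
  have hPQ : P * (1 - P) = 0 := by rw [mul_sub, mul_one, hPi.eq, sub_self]
  have hQP : (1 - P) * P = 0 := by rw [sub_mul, one_mul, hPi.eq, sub_self]
  have hmapR : ∀ w : List (Module.End ℂ V), (∀ a ∈ w, a ∈ 𝒜) → w = [] ∨ (w.map ρ).prod ∈ R := by
    intro w
    induction w with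
    | nil => intro _; exact Or.inl rfl
    | cons a w ih =>
      intro hw
      right
      rw [List.map_cons, List.prod_cons]
      rcases ih fun b hb => hw b (by simp [hb]) with h | h
      · subst h; simpa using hρ a (hw a (by simp))
      · exact R.mul_mem (hρ a (hw a (by simp))) h
  have hzero : ∀ w : List (Module.End ℂ V), (∀ a ∈ w, a ∈ 𝒜) →
      Module.finrank ℂ V ≤ w.length → (w.map ρ).prod = 0 := fun w hw hlen =>
    list_prod_eq_zero_of_trace_eq_zero R (fun a ha => (mem_traceKernel.1 ha).2) _
      (fun a ha => by
        obtain ⟨b, hb, rfl⟩ := List.mem_map.1 ha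
        exact hρ b (hw b hb)) (by simpa using hlen)
  -- A `P` arising on the left meets `P r (1 - P) s P = P (r s) P - (P r P) s P`, and both terms
  -- vanish.
  have hleft : ∀ w : List (Module.End ℂ V), (∀ a ∈ w, a ∈ 𝒜) → ∀ s ∈ R,
      w.prod * ((1 - P) * s * P) = (w.map ρ).prod * ((1 - P) * s * P) := by
    intro w
    induction w with
    | nil => intro _ s _; simp
    | cons a w ih =>
      intro hw s hs
      have hw' : ∀ b ∈ w, b ∈ 𝒜 := fun b hb => hw b (by simp [hb])
      have h0 : P * ((w.map ρ).prod * ((1 - P) * s * P)) = 0 := by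
        rcases hmapR w hw' with h | h
        · subst h
          rw [List.map_nil, List.prod_nil, one_mul, ← mul_assoc, ← mul_assoc, hPQ, zero_mul,
            zero_mul]
        · have : P * ((w.map ρ).prod * ((1 - P) * s * P))
              = P * ((w.map ρ).prod * s) * P - P * (w.map ρ).prod * P * (s * P) := by
            noncomm_ring
          rw [this, hPRP _ (R.mul_mem h hs), hPRP _ h, zero_mul, sub_zero]
      rw [List.prod_cons, mul_assoc, ih hw' s hs, List.map_cons, List.prod_cons]
      conv_lhs => rw [hsplit a]
      rw [add_mul, smul_mul_assoc, h0, smul_zero, add_zero, mul_assoc (ρ a)]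
  have hright : ∀ w : List (Module.End ℂ V), (∀ a ∈ w, a ∈ 𝒜) →
      l.prod * (1 - P) * w.prod = l.prod * (1 - P) * (w.map ρ).prod := by
    intro w
    induction w using List.reverseRecOn with
    | nil => intro _; simp
    | append_singleton w a ih =>
      intro hw
      have hw' : ∀ b ∈ w, b ∈ 𝒜 := fun b hb => hw b (by simp [hb])
      -- By `hleft` the left word may be replaced by its `R` components, whose product is zero since
      -- `l` is long.
      have h0 : l.prod * (1 - P) * (w.map ρ).prod * P = 0 := by
        rcases hmapR w hw' with h | h
        · subst h
          rw [List.map_nil, List.prod_nil, mul_one, mul_assoc, hQP, mul_zero]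
        · rw [mul_assoc, mul_assoc, ← mul_assoc (1 - P), hleft l hl _ h, hzero l hl hlen, zero_mul]
      rw [List.prod_append, List.prod_singleton, ← mul_assoc, ih hw', List.map_append,
        List.prod_append, List.map_singleton, List.prod_singleton]
      conv_lhs => rw [hsplit a]
      rw [mul_add, mul_smul_comm, h0, smul_zero, add_zero, mul_assoc _ _ (ρ a)]
  have := hright l' hl'
  rw [hzero l' hl' hlen', mul_zero, mul_sub, mul_one, sub_mul, sub_eq_zero] at this
  exact this

end TraceCharacter

/-! ### Parity signs -/

section Signs

lemma sgn_zero : sgn 0 = 1 := by simp [sgn]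

lemma sgn_one : sgn 1 = -1 := by simp [sgn, ZMod.val_one]

lemma eq_zero_or_one (a : ZMod 2) : a = 0 ∨ a = 1 := by
  revert a; decide

lemma sgn_add (a b : ZMod 2) : sgn (a + b) = sgn a * sgn b := by
  rcases eq_zero_or_one a with rfl | rfl <;> rcases eq_zero_or_one b with rfl | rfl <;>
    simp [sgn_zero, sgn_one, show (1 + 1 : ZMod 2) = 0 from rfl]

lemma sgn_mul_self (a : ZMod 2) : sgn a * sgn a = 1 := by
  rw [← sgn_add, CharTwo.add_self_eq_zero, sgn_zero]

lemma star_sgn (a : ZMod 2) : star (sgn a) = sgn a := by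
  simp [sgn]

lemma sgn_eq_one_iff (a : ZMod 2) : sgn a = 1 ↔ a = 0 := by
  rcases eq_zero_or_one a with rfl | rfl
  · simp [sgn_zero]
  · simp only [sgn_one, one_ne_zero, iff_false]; norm_num

end Signs

/-! ### Stacked and transfer matrices of the blocked tensor -/

section Blocking

variable {ι χ : Type*} [Fintype χ] [DecidableEq χ] (p : ι → ZMod 2) (q : χ → ZMod 2)
  (U : ι → ι → Matrix χ χ ℂ)

/-- The power `Z^σ` of the diagonal parity operator. -/
def parityPow (σ : ZMod 2) : Matrix χ χ ℂ := Matrix.diagonal fun a => sgn (q a * σ)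

omit [Fintype χ] in
lemma parityPow_one : parityPow q 1 = parityOp q := by simp [parityPow, parityOp]

lemma parityPow_add (σ τ : ZMod 2) : parityPow q (σ + τ) = parityPow q σ * parityPow q τ := by
  simp [parityPow, mul_add, sgn_add]

lemma parityOp_mul_self : parityOp q * parityOp q = 1 := by
  simp [parityOp, sgn_mul_self]

omit [Fintype χ] in
lemma map_star_parityOp : (parityOp q).map star = parityOp q := by
  rw [parityOp, Matrix.diagonal_map (star_zero ℂ)]
  simp only [star_sgn]

lemma parityPow_mul_of_parityOp_mul {A : Matrix χ χ ℂ} {τ : ZMod 2}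
    (h : parityOp q * A = sgn τ • (A * parityOp q)) (σ : ZMod 2) :
    parityPow q σ * A = sgn (σ * τ) • (A * parityPow q σ) := by
  rcases eq_zero_or_one σ with rfl | rfl
  · simp [parityPow, sgn_zero]
  · rw [parityPow_one, one_mul, h]

omit [DecidableEq χ] in
lemma map_star_mul (A B : Matrix χ χ ℂ) : (A * B).map star = A.map star * B.map star :=
  Matrix.map_mul (f := starRingEnd ℂ)

omit [Fintype χ] [DecidableEq χ] in
lemma map_star_smul (c : ℂ) (A : Matrix χ χ ℂ) : (c • A).map star = star c • A.map star := by
  ext; simp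

variable {p q U} in
lemma IsEven.parityPow_mul (hU : IsEven p q U) (n m : ι) (σ : ZMod 2) :
    parityPow q σ * (U n m).map star =
      sgn (σ * (p n + p m)) • ((U n m).map star * parityPow q σ) := by
  refine parityPow_mul_of_parityOp_mul q ?_ σ
  have := congrArg (fun A : Matrix χ χ ℂ => A.map star) (hU n m)
  simpa only [map_star_mul, map_star_smul, map_star_parityOp, star_sgn] using this

lemma blockTensor_zero (n m : Fin 0 → ι) : blockTensor p U 0 n m = 1 := by
  simp [blockTensor, sgn_zero]

lemma sum_Ioi_succ {M : Type*} [AddCommMonoid M] {N : ℕ} (f : Fin (N + 1) → Fin (N + 1) → M) :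
    ∑ i, ∑ j ∈ Finset.Ioi i, f i j =
      ∑ j : Fin N, f 0 j.succ + ∑ i : Fin N, ∑ j ∈ Finset.Ioi i, f i.succ j.succ := by
  have h : ∀ {K : ℕ} (i : Fin K) (g : Fin K → M),
      ∑ j ∈ Finset.Ioi i, g j = ∑ j, if i < j then g j else 0 := by
    intro K i g
    rw [← Finset.sum_filter]
    exact Finset.sum_congr (by ext; simp) fun _ _ => rfl
  simp only [h, Fin.sum_univ_succ, if_false, Fin.succ_pos, if_true, zero_add,
    Fin.succ_lt_succ_iff, Fin.not_lt_zero]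

lemma blockParity_cons {N : ℕ} (a : ι) (n : Fin N → ι) :
    blockParity p (N + 1) (Fin.cons a n) = p a + blockParity p N n := by
  simp [blockParity, Fin.sum_univ_succ]

lemma blockTensor_cons {N : ℕ} (a b : ι) (n m : Fin N → ι) :
    blockTensor p U (N + 1) (Fin.cons a n) (Fin.cons b m) =
      sgn (p b * (blockParity p N n + blockParity p N m)) •
        (U a b * blockTensor p U N n m) := by
  simp only [blockTensor, blockParity, List.ofFn_succ, List.prod_cons, Fin.cons_zero,
    Fin.cons_succ]
  rw [sum_Ioi_succ]
  simp only [Fin.cons_zero, Fin.cons_succ]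
  rw [sgn_add, ← Finset.mul_sum, Finset.sum_add_distrib, Matrix.mul_smul, smul_smul]

variable {p q U} in
lemma IsEven.blockTensor (hU : IsEven p q U) (N : ℕ) :
    IsEven (blockParity p N) q (blockTensor p U N) := by
  induction N with
  | zero => intro n m; simp [blockTensor_zero, blockParity, sgn_zero]
  | succ N ih =>
    intro n m
    induction n using Fin.consCases with | _ a n => ?_
    induction m using Fin.consCases with | _ b m => ?_
    rw [blockTensor_cons, blockParity_cons, blockParity_cons, Matrix.mul_smul, ← mul_assoc, hU a b,
      Matrix.smul_mul, mul_assoc, ih n m, Matrix.mul_smul, Matrix.smul_mul, ← mul_assoc,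
      smul_comm (sgn (p a + _ + _)), smul_smul (sgn (p a + p b)), ← sgn_add]
    congr 3
    ring

variable [Fintype ι]

lemma sum_fin_cons {M : Type*} [AddCommMonoid M] {N : ℕ} (f : (Fin (N + 1) → ι) → M) :
    ∑ n, f n = ∑ a, ∑ n : Fin N → ι, f (Fin.cons a n) := by
  rw [← (Fin.consEquiv fun _ : Fin (N + 1) => ι).sum_comp, Fintype.sum_prod_type]
  rfl

lemma stacked_eq_sum (k i : ι) :
    stacked p q U k i = ∑ j, ((U j k).map star * parityPow q (p k + p i)) ⊗ₖ U j i := by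
  ext a b
  simp only [stacked, Matrix.of_apply, Matrix.sum_apply, Matrix.kroneckerMap_apply, parityPow,
    Matrix.mul_diagonal, Matrix.map_apply]
  exact Finset.sum_congr rfl fun j _ => by ring

omit [Fintype χ] [DecidableEq χ] in
lemma transfer_eq_sum :
    transfer U = (1 / (Fintype.card ι : ℂ)) • ∑ i, stacked p q U i i := by
  ext a b
  simp only [transfer, stacked, Matrix.of_apply, Matrix.sum_apply, Matrix.smul_apply, smul_eq_mul,
    CharTwo.add_self_eq_zero, mul_zero, sgn_zero, one_mul]

-- Moving the parity factor of the first site past the conjugated block tensor costs a sign by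
-- evenness. With the two blocking signs, everything cancels except the sign displayed.
variable {p q U} in
lemma IsEven.stacked_blockTensor_cons (hU : IsEven p q U) {N : ℕ} (a b : ι) (k i : Fin N → ι) :
    stacked (blockParity p (N + 1)) q (FermionicMPU.blockTensor p U (N + 1))
        (Fin.cons a k) (Fin.cons b i) =
      sgn (p b * (blockParity p N k + blockParity p N i)) •
        (stacked p q U a b *
          stacked (blockParity p N) q (FermionicMPU.blockTensor p U N) k i) := by
  simp only [stacked_eq_sum]
  rw [sum_fin_cons, Finset.sum_mul_sum, Finset.smul_sum]
  refine Finset.sum_congr rfl fun c _ => ?_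
  rw [Finset.smul_sum]
  refine Finset.sum_congr rfl fun j _ => ?_
  simp only [blockTensor_cons, blockParity_cons]
  rw [← Matrix.mul_kronecker_mul, mul_assoc (Matrix.map (U c a) star),
    ← mul_assoc (parityPow q (p a + p b)), (hU.blockTensor N).parityPow_mul, map_star_smul,
    map_star_mul, star_sgn]
  simp only [Matrix.smul_mul, Matrix.mul_smul, Matrix.smul_kronecker, Matrix.kronecker_smul,
    smul_smul, ← sgn_add, mul_assoc]
  rw [show p a + blockParity p N k + (p b + blockParity p N i) =
    (p a + p b) + (blockParity p N k + blockParity p N i) by ring, parityPow_add]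
  congr 2
  generalize p a = x, p b = y, blockParity p N j = u, blockParity p N k = v, blockParity p N i = w
  revert x y u v w
  decide

-- Only the triviality of the sign for `k = i` matters later, since off the diagonal the relevant
-- quantities vanish.
variable {p q U} in
lemma IsEven.stacked_blockTensor (hU : IsEven p q U) {N : ℕ} (k i : Fin N → ι) :
    ∃ s : ZMod 2, (k = i → s = 0) ∧
      stacked (blockParity p N) q (FermionicMPU.blockTensor p U N) k i =
        sgn s • (List.ofFn fun j => stacked p q U (k j) (i j)).prod := by
  induction N with
  | zero =>
    refine ⟨0, fun _ => rfl, ?_⟩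
    simp only [stacked_eq_sum, blockTensor_zero, List.ofFn_zero, List.prod_nil, sgn_zero, one_smul]
    simp [blockParity, parityPow, sgn_zero]
  | succ N ih =>
    induction k using Fin.consCases with | _ a k => ?_
    induction i using Fin.consCases with | _ b i => ?_
    obtain ⟨s, hs, h⟩ := ih k i
    refine ⟨p b * (blockParity p N k + blockParity p N i) + s, ?_, ?_⟩
    · intro he
      obtain ⟨rfl, rfl⟩ := Fin.cons_injective2 he
      rw [hs rfl, CharTwo.add_self_eq_zero, mul_zero, add_zero]
    · rw [hU.stacked_blockTensor_cons, h, List.ofFn_succ, List.prod_cons, Matrix.mul_smul,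
        smul_smul, ← sgn_add]
      simp only [Fin.cons_zero, Fin.cons_succ]

variable {p q U} in
lemma IsEven.transfer_blockTensor (hU : IsEven p q U) (N : ℕ) :
    transfer (FermionicMPU.blockTensor p U N) = transfer U ^ N := by
  induction N with
  | zero =>
    rw [transfer_eq_sum (fun _ : Fin 0 → ι => 0) q, pow_zero]
    simp only [stacked_eq_sum, blockTensor_zero]
    simp [parityPow, sgn_zero]
  | succ N ih =>
    rw [pow_succ', ← ih, transfer_eq_sum (blockParity p (N + 1)) q, transfer_eq_sum p q U,
      transfer_eq_sum (blockParity p N) q (FermionicMPU.blockTensor p U N),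
      sum_fin_cons,
      Matrix.smul_mul, Matrix.mul_smul, smul_smul, Finset.sum_mul_sum]
    congr 1
    · simp [pow_succ]
    · refine Finset.sum_congr rfl fun a _ => Finset.sum_congr rfl fun i _ => ?_
      rw [hU.stacked_blockTensor_cons, CharTwo.add_self_eq_zero, mul_zero, sgn_zero, one_smul]

end Blocking

/-! ### Matrix entries of the chain operator and unitarity -/

section ChainOperator

variable {ι χ : Type*} [Fintype ι] [DecidableEq ι] [Fintype χ] [DecidableEq χ] (p : ι → ZMod 2)

/-- The operator on `N + 1` sites that acts as `A` on the last `N` sites and picks up the sign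
`(-1)^{σ |t 0|}` on the first one. -/
def prependSite {N : ℕ} (σ : ZMod 2) (A : Matrix (Fin N → ι) (Fin N → ι) ℂ) :
    Matrix (Fin (N + 1) → ι) (Fin (N + 1) → ι) ℂ :=
  Matrix.of fun s t =>
    if s 0 = t 0 then sgn (σ * p (t 0)) * A (Fin.tail s) (Fin.tail t) else 0

omit [Fintype ι] in
lemma prependSite_zero_one {N : ℕ} : prependSite p 0 (1 : Matrix (Fin N → ι) (Fin N → ι) ℂ) = 1 := by
  ext s t
  induction s using Fin.consCases with | _ a s => ?_
  induction t using Fin.consCases with | _ b t => ?_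
  by_cases h : a = b
  · by_cases h' : s = t
    · subst h h'; simp [prependSite, sgn_zero]
    · simp [prependSite, h, h', sgn_zero, Matrix.one_apply, Fin.cons_inj]
  · simp [prependSite, h, Matrix.one_apply, Fin.cons_inj]

lemma prependSite_mul {N : ℕ} (σ τ : ZMod 2) (A B : Matrix (Fin N → ι) (Fin N → ι) ℂ) :
    prependSite p σ A * prependSite p τ B = prependSite p (σ + τ) (A * B) := by
  ext s t
  induction s using Fin.consCases with | _ a s => ?_
  induction t using Fin.consCases with | _ b t => ?_
  rw [Matrix.mul_apply, sum_fin_cons]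
  simp only [prependSite, Matrix.of_apply, Fin.cons_zero, Fin.tail_cons,
    Matrix.mul_apply]
  rw [Finset.sum_eq_single a (fun c _ hc => by simp [Ne.symm hc]) (by simp)]
  by_cases h : a = b
  · subst h
    simp only [if_true, add_mul, sgn_add, Finset.mul_sum]
    exact Finset.sum_congr rfl fun r _ => by ring
  · simp [h]

omit [Fintype ι] in
lemma siteOp_succ {N : ℕ} (j : Fin N) (n m : ι) :
    siteOp p j.succ n m = prependSite p (p n + p m) (siteOp p j n m) := by
  ext s t
  induction s using Fin.consCases with | _ a s => ?_
  induction t using Fin.consCases with | _ b t => ?_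
  have hsum : ∑ l ∈ Finset.Iio j.succ, p ((Fin.cons b t : Fin (N + 1) → ι) l) =
      p b + ∑ l ∈ Finset.Iio j, p (t l) := by
    have h : ∀ {K : ℕ} (i : Fin K) (g : Fin K → ZMod 2),
        ∑ j ∈ Finset.Iio i, g j = ∑ j, if j < i then g j else 0 := by
      intro K i g
      rw [← Finset.sum_filter]
      exact Finset.sum_congr (by ext; simp) fun _ _ => rfl
    rw [h, h, Fin.sum_univ_succ]
    simp
  simp only [siteOp, prependSite, Matrix.of_apply, Fin.cons_succ, Fin.cons_zero, Fin.tail_cons,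
    hsum, ← Fin.cons_update, Fin.cons_inj]
  by_cases h : a = b <;> by_cases h1 : t j = m ∧ s = Function.update t j n <;>
    simp [h, h1, mul_add, sgn_add]

lemma siteOp_zero_mul_prependSite {N : ℕ} (n m a b : ι) (σ : ZMod 2)
    (A : Matrix (Fin N → ι) (Fin N → ι) ℂ) (s t : Fin N → ι) :
    (siteOp p (0 : Fin (N + 1)) n m * prependSite p σ A) (Fin.cons a s) (Fin.cons b t) =
      if a = n ∧ b = m then sgn (σ * p m) * A s t else 0 := by
  rw [Matrix.mul_apply, sum_fin_cons]
  simp only [prependSite, siteOp, Matrix.of_apply, Fin.cons_zero,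
    Fin.tail_cons, Fin.update_cons_zero, Fin.cons_inj]
  have h0 : Finset.Iio (0 : Fin (N + 1)) = ∅ := by ext; simp
  rw [Finset.sum_eq_single m (fun c _ hc => by simp [hc]) (by simp),
    Finset.sum_eq_single s (fun c _ hc => by simp [Ne.symm hc]) (by simp)]
  by_cases h2 : b = m
  · subst h2
    by_cases h1 : a = n <;> simp [h1, h0, sgn_zero]
  · simp [h2, Ne.symm h2]

/-- The product is a signed matrix unit: each `siteOp` moved past the first site contributes its
parity there, and these signs add up to the blocking sign. -/
lemma prod_siteOp_apply {N : ℕ} (n m s t : Fin N → ι) :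
    (List.ofFn fun j => siteOp p j (n j) (m j)).prod s t =
      if s = n ∧ t = m then sgn (∑ i, ∑ j ∈ Finset.Ioi i, p (m i) * (p (n j) + p (m j)))
      else 0 := by
  have hpre : ∀ {K M : ℕ} (g : Fin K → Fin M) (n m : Fin K → ι),
      (List.ofFn fun j => siteOp p (g j).succ (n j) (m j)).prod =
        prependSite p (∑ j, (p (n j) + p (m j)))
          (List.ofFn fun j => siteOp p (g j) (n j) (m j)).prod := by
    intro K M g n m
    induction K with
    | zero => simp [prependSite_zero_one]
    | succ K ih =>
      rw [List.ofFn_succ, List.prod_cons, ih (fun j => g j.succ), siteOp_succ, prependSite_mul,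
        List.ofFn_succ, List.prod_cons, Fin.sum_univ_succ]
  induction N with
  | zero => simp [sgn_zero, Subsingleton.elim s n, Subsingleton.elim t m, Subsingleton.elim n m]
  | succ N ih =>
    induction s using Fin.consCases with | _ a s => ?_
    induction t using Fin.consCases with | _ b t => ?_
    induction n using Fin.consCases with | _ c n => ?_
    induction m using Fin.consCases with | _ e m => ?_
    rw [List.ofFn_succ, List.prod_cons]
    simp only [Fin.cons_zero, Fin.cons_succ]
    rw [hpre (fun j => j) n m, siteOp_zero_mul_prependSite, ih]
    simp only [sum_Ioi_succ, Fin.cons_zero, Fin.cons_succ, Fin.cons_inj]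
    by_cases h1 : a = c <;> by_cases h2 : b = e <;> by_cases h3 : s = n <;> by_cases h4 : t = m <;>
      simp [h1, h2, h3, h4, sgn_add, ← Finset.mul_sum, mul_comm]

lemma chainOp_apply (S : Matrix χ χ ℂ) (U : ι → ι → Matrix χ χ ℂ) (N : ℕ) (s t : Fin N → ι) :
    chainOp p S U N s t = (S * blockTensor p U N s t).trace := by
  simp only [chainOp, Matrix.sum_apply, Matrix.smul_apply, prod_siteOp_apply]
  rw [Finset.sum_eq_single s (fun n _ hn => by simp [Ne.symm hn]) (by simp),
    Finset.sum_eq_single t (fun n _ hn => by simp [Ne.symm hn]) (by simp)]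
  simp [blockTensor, mul_comm]

variable {p} {q : χ → ZMod 2}

-- Evenness kills diagonal entries of odd components, so wherever both factors are nonzero `p k + p
-- i = 0` and the sign in `stacked` is trivial.
omit [DecidableEq ι] in
lemma IsEven.trace_stacked {V : ι → ι → Matrix χ χ ℂ} (hV : IsEven p q V) (k i : ι) :
    (stacked p q V k i).trace = ∑ j, star (V j k).trace * (V j i).trace := by
  have hdiag : ∀ n m a, V n m a a ≠ 0 → p n + p m = 0 := by
    intro n m a ha
    have := congrFun (congrFun (hV n m) a) a
    simp only [parityOp, Matrix.diagonal_mul, Matrix.smul_apply, Matrix.mul_diagonal,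
      smul_eq_mul] at this
    have hne : sgn (q a) ≠ 0 := fun h => by simpa [h] using sgn_mul_self (q a)
    rw [mul_comm (V n m a a), mul_left_comm] at this
    have h1 := mul_left_cancel₀ hne this
    rw [← sgn_eq_one_iff]
    exact mul_right_cancel₀ ha (by rw [one_mul, ← h1])
  simp only [Matrix.trace, Matrix.diag_apply, stacked, Matrix.of_apply, Fintype.sum_prod_type,
    star_sum, Finset.sum_mul_sum]
  simp only [Finset.sum_comm (s := (Finset.univ : Finset χ)) (t := (Finset.univ : Finset ι))]
  refine Finset.sum_congr rfl fun j _ => ?_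
  refine Finset.sum_congr rfl fun a _ => Finset.sum_congr rfl fun b _ => ?_
  by_cases ha : V j k a a = 0
  · simp [ha]
  by_cases hb : V j i b b = 0
  · simp [hb]
  have : p k + p i = 0 := by
    have h1 := hdiag j k a ha
    have h2 := hdiag j i b hb
    have h3 : p k + p i = (p j + p k) + (p j + p i) := by
      have := CharTwo.add_self_eq_zero (p j)
      linear_combination -this
    rw [h3, h1, h2, add_zero]
  rw [this, mul_zero, sgn_zero, one_mul]

/-- This is the `(k, i)` entry of `U^{(N)†} U^{(N)} = 1`. -/
lemma trace_prod_stacked {U : ι → ι → Matrix χ χ ℂ} {c : ℂ}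
    (h : GeneratesAPUnitary p q (c • (1 : Matrix χ χ ℂ)) U) {N : ℕ} (hN : 1 ≤ N)
    (k i : Fin N → ι) :
    star c * c * (List.ofFn fun j => stacked p q U (k j) (i j)).prod.trace =
      if k = i then 1 else 0 := by
  obtain ⟨hU, -, -, huni⟩ := h
  have h1 := congrFun (congrFun (Matrix.mem_unitaryGroup_iff'.1 (huni N hN)) k) i
  rw [Matrix.mul_apply, Matrix.one_apply] at h1
  simp only [Matrix.star_apply, chainOp_apply, Matrix.smul_mul, one_mul, Matrix.trace_smul,
    smul_eq_mul, star_mul'] at h1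
  obtain ⟨s, hs, hst⟩ := hU.stacked_blockTensor k i
  have h2 := (hU.blockTensor N).trace_stacked k i
  rw [hst, Matrix.trace_smul, smul_eq_mul] at h2
  have h3 : star c * c * (sgn s * (List.ofFn fun j => stacked p q U (k j) (i j)).prod.trace) =
      if k = i then 1 else 0 := by
    rw [h2, ← h1, Finset.mul_sum]
    exact Finset.sum_congr rfl fun j _ => by ring
  have h4 : sgn s * (if k = i then (1 : ℂ) else 0) = if k = i then 1 else 0 := by
    by_cases hki : k = i
    · simp [hs hki, sgn_zero]
    · simp [hki]
  rw [← h4, ← h3]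
  linear_combination (-(star c * c * (List.ofFn fun j => stacked p q U (k j) (i j)).prod.trace)) *
    sgn_mul_self s

end ChainOperator

/-! ### Simpleness from traces of words -/

section Words

variable {J κ : Type*} [Fintype J] [Fintype κ] [DecidableEq κ]

/-- The words of length `n` in the matrices `B j` satisfy the conditions of simpleness with respect
to the `n`-th power of `∑ j, c j • B j` and the weights `∏ a, φ (k a)`. -/
def IsWordSimple (B : J → Matrix κ κ ℂ) (φ c : J → ℂ) (n : ℕ) : Prop :=
  let E := (∑ j, c j • B j) ^ n
  E * E = E ∧
  (∀ k : Fin n → J, E * (List.ofFn fun a => B (k a)).prod * E = (∏ a, φ (k a)) • E) ∧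
  ∀ k k' : Fin n → J, (List.ofFn fun a => B (k a)).prod * (List.ofFn fun a => B (k' a)).prod =
    (List.ofFn fun a => B (k a)).prod * E * (List.ofFn fun a => B (k' a)).prod

/-- Nonempty words span the non-unital algebra generated by the `B j`, so the hypothesis on words
makes the trace multiplicative there. The empty word is excluded, as its trace is `card κ`. -/
lemma isWordSimple_of_trace {B : J → Matrix κ κ ℂ} {φ c : J → ℂ} {n : ℕ} (hn : Fintype.card κ ≤ n)
    (hn1 : 1 ≤ n) (hc : ∑ j, c j * φ j = 1)
    (htr : ∀ N, 1 ≤ N → ∀ k : Fin N → J,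
      (List.ofFn fun a => B (k a)).prod.trace = ∏ a, φ (k a)) :
    IsWordSimple B φ c n := by
  let T : Matrix κ κ ℂ ≃ₐ[ℂ] Module.End ℂ (κ → ℂ) := Matrix.toLinAlgEquiv'
  have hT : ∀ A, LinearMap.trace ℂ (κ → ℂ) (T A) = A.trace := fun A => Matrix.trace_toLin'_eq A
  let 𝒜 : NonUnitalSubalgebra ℂ (Module.End ℂ (κ → ℂ)) :=
    NonUnitalAlgebra.adjoin ℂ (Set.range fun j => T (B j))
  have hB : ∀ j, T (B j) ∈ 𝒜 := fun j =>
    NonUnitalAlgebra.subset_adjoin ℂ (Set.mem_range_self j)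
  have hlist : ∀ l : List J, l ≠ [] → ((l.map B).prod).trace = (l.map φ).prod := by
    intro l hl
    have := htr l.length (List.length_pos_iff.2 hl) l.get
    rw [← List.prod_ofFn] at this
    have h1 : (List.ofFn fun a => B (l.get a)) = l.map B := by
      conv_rhs => rw [← List.ofFn_get l, List.map_ofFn]
      rfl
    have h2 : (List.ofFn fun a => φ (l.get a)) = l.map φ := by
      conv_rhs => rw [← List.ofFn_get l, List.map_ofFn]
      rfl
    rwa [h1, h2] at this
  have hcl : ∀ x ∈ Subsemigroup.closure (Set.range fun j => T (B j)),
      ∃ l : List J, l ≠ [] ∧ x = T (l.map B).prod := by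
    intro x hx
    induction hx using Subsemigroup.closure_induction with
    | mem x hx =>
      obtain ⟨j, rfl⟩ := hx
      exact ⟨[j], by simp, by simp⟩
    | mul x y _ _ hx hy =>
      obtain ⟨l, hl, rfl⟩ := hx
      obtain ⟨l', -, rfl⟩ := hy
      exact ⟨l ++ l', by simp [hl], by rw [List.map_append, List.prod_append, map_mul]⟩
  have hspan : ∀ x ∈ 𝒜, x ∈ Submodule.span ℂ
      (Subsemigroup.closure (Set.range fun j => T (B j)) : Set (Module.End ℂ (κ → ℂ))) := by
    intro x hx
    rw [← NonUnitalAlgebra.adjoin_eq_span]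
    exact hx
  have hmul : ∀ a ∈ 𝒜, ∀ b ∈ 𝒜, LinearMap.trace ℂ _ (a * b) =
      LinearMap.trace ℂ _ a * LinearMap.trace ℂ _ b := by
    intro a ha b hb
    replace ha := hspan a ha
    replace hb := hspan b hb
    induction ha, hb using Submodule.span_induction₂ with
    | mem_mem x y hx hy =>
      obtain ⟨l, hl, rfl⟩ := hcl x hx
      obtain ⟨l', hl', rfl⟩ := hcl y hy
      rw [← map_mul, hT, hT, hT, ← List.prod_append, ← List.map_append, hlist _ (by simp [hl]),
        hlist _ hl, hlist _ hl', List.map_append, List.prod_append]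
    | zero_left y _ => simp
    | zero_right x _ => simp
    | add_left x y z _ _ _ h1 h2 => rw [add_mul, map_add, map_add, h1, h2, add_mul]
    | add_right x y z _ _ _ h1 h2 => rw [mul_add, map_add, map_add, h1, h2, mul_add]
    | smul_left r x y _ _ h => rw [smul_mul_assoc, map_smul, map_smul, h, smul_mul_assoc]
    | smul_right r x y _ _ h => rw [mul_smul_comm, map_smul, map_smul, h, mul_smul_comm]
  have hE : T (∑ j, c j • B j) ∈ 𝒜 := by
    rw [map_sum]
    refine 𝒜.toSubmodule.sum_mem fun j _ => ?_
    rw [map_smul]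
    exact 𝒜.smul_mem _ (hB j)
  have hEt : LinearMap.trace ℂ _ (T (∑ j, c j • B j)) = 1 := by
    rw [hT, Matrix.trace_sum, ← hc]
    refine Finset.sum_congr rfl fun j _ => ?_
    have := hlist [j] (by simp)
    simp only [List.map_singleton, List.prod_singleton] at this
    rw [Matrix.trace_smul, this, smul_eq_mul]
  have hfin : Module.finrank ℂ (κ → ℂ) ≤ n := by simpa using hn
  obtain ⟨hPm, hPi, hPt⟩ := isIdempotentElem_pow_finrank hmul hE hEt hfin hn1
  have hword : ∀ k : Fin n → J, T (List.ofFn fun a => B (k a)).prod =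
      (List.ofFn fun a => T (B (k a))).prod := by
    intro k
    rw [map_list_prod, List.map_ofFn]
    rfl
  have hmemA : ∀ k : Fin n → J, ∀ x ∈ List.ofFn fun a => T (B (k a)), x ∈ 𝒜 := by
    intro k x hx
    obtain ⟨a, rfl⟩ := List.mem_ofFn.1 hx
    exact hB _
  have hwordA : ∀ k : Fin n → J, T (List.ofFn fun a => B (k a)).prod ∈ 𝒜 := by
    intro k
    have h : ∀ l : List J, l ≠ [] → T (l.map B).prod ∈ 𝒜 := by
      intro l
      induction l with
      | nil => intro h; exact absurd rfl h
      | cons j l ih =>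
        intro _
        rw [List.map_cons, List.prod_cons, map_mul]
        by_cases hl : l = []
        · subst hl; simpa using hB j
        · exact 𝒜.mul_mem (hB j) (ih hl)
    have := h (List.ofFn k) (by
      rw [Ne, List.ofFn_eq_nil_iff]; omega)
    rwa [List.map_ofFn] at this
  rw [← map_pow] at hPm hPi hPt
  refine ⟨T.injective (by rw [map_mul, hPi.eq]), fun k => T.injective ?_, fun k k' =>
    T.injective ?_⟩
  · rw [map_mul, map_mul, mul_mul_eq_trace_smul hPi hPt, hmul _ hPm _ (hwordA k), hPt, one_mul, hT,
      htr n hn1, map_smul]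
  · rw [map_mul, map_mul, map_mul, hword, hword]
    exact list_prod_mul_list_prod hmul hPm hPi hPt _ _ (hmemA k) (hmemA k') (by simpa using hfin)
      (by simpa using hfin)

lemma prod_ofFn_mul {N : ℕ} (hN : 1 ≤ N) {Q : Matrix κ κ ℂ} (hQ : Q * Q = Q)
    (A : Fin N → Matrix κ κ ℂ) (hA : ∀ a, Q * A a = A a * Q) :
    (List.ofFn fun a => Q * A a).prod = Q * (List.ofFn A).prod := by
  induction N, hN using Nat.le_induction with
  | base => simp
  | succ N hN ih =>
    rw [List.ofFn_succ, List.prod_cons, ih _ fun a => hA a.succ, List.ofFn_succ, List.prod_cons,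
      hA 0, mul_assoc, ← mul_assoc Q Q, hQ, ← mul_assoc, ← hA 0, mul_assoc]

lemma mul_prod_ofFn {N : ℕ} {Q : Matrix κ κ ℂ} (A : Fin N → Matrix κ κ ℂ)
    (hA : ∀ a, Q * A a = A a * Q) : Q * (List.ofFn A).prod = (List.ofFn A).prod * Q :=
  Commute.list_prod_right _ _ fun x hx => by
    obtain ⟨a, rfl⟩ := List.mem_ofFn.1 hx
    exact hA a

/-- `Q` is a central projection for the `B j`, and the weights agree on both halves, so each
identity can be checked after multiplication by `Q` and by `1 - Q`. -/
lemma IsWordSimple.of_add {B : J → Matrix κ κ ℂ} {φ c : J → ℂ} {n : ℕ} (hn : 1 ≤ n)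
    {Q : Matrix κ κ ℂ} (hQ : Q * Q = Q) (hQB : ∀ j, Q * B j = B j * Q)
    (h1 : IsWordSimple (fun j => Q * B j) φ c n)
    (h2 : IsWordSimple (fun j => (1 - Q) * B j) φ c n) : IsWordSimple B φ c n := by
  have key : ∀ R : Matrix κ κ ℂ, R * R = R → (∀ j, R * B j = B j * R) →
      IsWordSimple (fun j => R * B j) φ c n →
      R * ((∑ j, c j • B j) ^ n * (∑ j, c j • B j) ^ n) = R * (∑ j, c j • B j) ^ n ∧
      (∀ k : Fin n → J,
        R * ((∑ j, c j • B j) ^ n * (List.ofFn fun a => B (k a)).prod * (∑ j, c j • B j) ^ n) =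
        R * ((∏ a, φ (k a)) • (∑ j, c j • B j) ^ n)) ∧
      ∀ k k' : Fin n → J,
        R * ((List.ofFn fun a => B (k a)).prod * (List.ofFn fun a => B (k' a)).prod) =
        R * ((List.ofFn fun a => B (k a)).prod * (∑ j, c j • B j) ^ n *
          (List.ofFn fun a => B (k' a)).prod) := by
    intro R hR hRB ⟨h1, h2, h3⟩
    have hsum : ∑ j, c j • (R * B j) = R * ∑ j, c j • B j := by
      simp only [Finset.mul_sum, Matrix.mul_smul]
    have hRE : Commute R (∑ j, c j • B j) :=
      Commute.sum_right _ _ _ fun j _ => Commute.smul_right (hRB j) _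
    have hpow : (R * ∑ j, c j • B j) ^ n = R * (∑ j, c j • B j) ^ n := by
      obtain ⟨m, rfl⟩ := Nat.exists_eq_add_of_le' hn
      rw [hRE.mul_pow, IsIdempotentElem.pow_succ_eq m hR]
    have hRP := hRE.pow_right n
    have hw := fun k : Fin n → J => prod_ofFn_mul hn hR (fun a => B (k a)) fun a => hRB (k a)
    have hRw := fun k : Fin n → J => mul_prod_ofFn (fun a => B (k a)) fun a => hRB (k a)
    simp only [hsum, hpow, hw] at h1 h2 h3
    have hmul : ∀ X Y, R * X = X * R → R * X * (R * Y) = R * (X * Y) := by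
      intro X Y hX
      rw [hX, mul_assoc, ← mul_assoc R R, hR, ← mul_assoc, ← hX, mul_assoc]
    refine ⟨?_, fun k => ?_, fun k k' => ?_⟩
    · rw [← hmul _ _ hRP.eq, h1]
    · rw [← hmul _ _ (hRP.mul_right (hRw k)).eq, ← hmul _ _ hRP.eq, h2, Matrix.mul_smul]
    · rw [← hmul _ _ (hRw k), h3, hmul _ _ (hRw k), hmul _ _ (Commute.mul_right (hRw k) hRP).eq]
  have hQ' : (1 - Q) * (1 - Q) = 1 - Q := by
    rw [mul_sub, mul_one, sub_mul, one_mul, hQ, sub_self, sub_zero]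
  have hQB' : ∀ j, (1 - Q) * B j = B j * (1 - Q) := fun j => by
    rw [sub_mul, mul_sub, hQB, one_mul, mul_one]
  obtain ⟨a1, a2, a3⟩ := key Q hQ hQB h1
  obtain ⟨b1, b2, b3⟩ := key (1 - Q) hQ' hQB' h2
  have glue : ∀ X Y : Matrix κ κ ℂ, Q * X = Q * Y → (1 - Q) * X = (1 - Q) * Y → X = Y := by
    intro X Y h h'
    rwa [sub_mul, sub_mul, h, one_mul, one_mul, sub_left_inj] at h'
  exact ⟨glue _ _ a1 b1, fun k => glue _ _ (a2 k) (b2 k), fun k k' => glue _ _ (a3 k k') (b3 k k')⟩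

end Words

/-! ### Type I and type II tensors -/

section Simpleness

variable {ι χ : Type*} [Fintype ι] [DecidableEq ι] [Fintype χ] [DecidableEq χ] {p : ι → ZMod 2}
  {q : χ → ZMod 2} {U : ι → ι → Matrix χ χ ℂ}

/-- The coefficients of the transfer matrix in the stacked matrices. -/
def transferCoeff (x : ι × ι) : ℂ := if x.1 = x.2 then 1 / (Fintype.card ι : ℂ) else 0

/-- The normalized trace `δ_{k,i}` of the operators `|k⟩⟨i|`. -/
def diagWeight (x : ι × ι) : ℂ := if x.1 = x.2 then 1 else 0

omit [Fintype χ] [DecidableEq χ] in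
lemma sum_transferCoeff_smul :
    ∑ x : ι × ι, transferCoeff x • stacked p q U x.1 x.2 = transfer U := by
  simp only [transfer_eq_sum p q U, transferCoeff, Fintype.sum_prod_type, ite_smul, zero_smul,
    Finset.sum_ite_eq, Finset.mem_univ, if_true, Finset.smul_sum]

lemma sum_transferCoeff_mul [Nonempty ι] :
    ∑ x : ι × ι, transferCoeff x * diagWeight x = 1 := by
  simp [transferCoeff, diagWeight, Fintype.sum_prod_type]

omit [Fintype ι] in
lemma prod_diagWeight {N : ℕ} (x : Fin N → ι × ι) :
    ∏ a, diagWeight (x a) = if (fun a => (x a).1) = fun a => (x a).2 then (1 : ℂ) else 0 := by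
  simp only [diagWeight, Finset.prod_ite_zero, Finset.prod_const_one, funext_iff, Finset.mem_univ,
    true_implies]

lemma isSimple_blockTensor (hU : IsEven p q U) {n : ℕ}
    (h : IsWordSimple (fun x : ι × ι => stacked p q U x.1 x.2) diagWeight transferCoeff n) :
    IsSimple (blockParity p n) q (blockTensor p U n) := by
  obtain ⟨h1, h2, h3⟩ := h
  rw [sum_transferCoeff_smul] at h1 h2 h3
  refine ⟨hU.blockTensor n, ?_, ?_, ?_⟩
  · intro k i
    obtain ⟨s, hs, hst⟩ := hU.stacked_blockTensor k i
    have h2' := h2 fun a => (k a, i a)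
    rw [prod_diagWeight] at h2'
    simp only at h2'
    rw [hst, hU.transfer_blockTensor, Matrix.mul_smul, Matrix.smul_mul, h2']
    by_cases hki : k = i
    · subst hki; simp [hs rfl, sgn_zero]
    · simp [hki]
  · intro k i k' i'
    obtain ⟨s, -, hst⟩ := hU.stacked_blockTensor k i
    obtain ⟨s', -, hst'⟩ := hU.stacked_blockTensor k' i'
    have h3' := h3 (fun a => (k a, i a)) fun a => (k' a, i' a)
    simp only at h3'
    rw [hst, hst', hU.transfer_blockTensor]
    simp only [Matrix.mul_smul, Matrix.smul_mul, h3']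
  · rw [hU.transfer_blockTensor, h1]

lemma isWordSimple_stacked_of_unit_boundary [Nonempty ι] {c : ℂ} (hc : star c * c = 1)
    (h : GeneratesAPUnitary p q (c • (1 : Matrix χ χ ℂ)) U) {n : ℕ}
    (hn : Fintype.card (χ × χ) ≤ n) (hn1 : 1 ≤ n) :
    IsWordSimple (fun x : ι × ι => stacked p q U x.1 x.2) diagWeight transferCoeff n := by
  refine isWordSimple_of_trace hn hn1 sum_transferCoeff_mul fun N hN x => ?_
  have := trace_prod_stacked h hN (fun a => (x a).1) fun a => (x a).2
  rwa [hc, one_mul, ← prod_diagWeight] at this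

-- The symmetry is $\sigma^x\otimes 1$ conjugated by `Y`; it still anticommutes with the parity
-- because `Y` is even.
omit [Fintype ι] [DecidableEq ι] in
lemma HasTypeIIForm.exists_odd_symmetry (h : HasTypeIIForm p q U) :
    ∃ X : Matrix χ χ ℂ, X * X = 1 ∧ X * parityOp q = -(parityOp q * X) ∧
      ∀ n m, X * U n m = U n m * X := by
  obtain ⟨D', e, M, Y, hZ, hY, hZY, hUM⟩ := h
  have hdet := (Matrix.isUnit_iff_isUnit_det Y).1 hY
  have hinv : Y⁻¹ * Y = 1 := Matrix.nonsing_inv_mul Y hdet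
  have hinv' : Y * Y⁻¹ = 1 := Matrix.mul_nonsing_inv Y hdet
  have hZY' : parityOp q * Y⁻¹ = Y⁻¹ * parityOp q :=
    calc parityOp q * Y⁻¹ = Y⁻¹ * Y * (parityOp q * Y⁻¹) := by rw [hinv, one_mul]
      _ = Y⁻¹ * (parityOp q * Y) * Y⁻¹ := by rw [hZY]; simp only [mul_assoc]
      _ = Y⁻¹ * parityOp q := by simp only [mul_assoc, hinv', mul_one]
  have hconj : ∀ A B : Matrix χ χ ℂ, Y * A * Y⁻¹ * (Y * B * Y⁻¹) = Y * (A * B) * Y⁻¹ := by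
    intro A B
    calc _ = Y * A * (Y⁻¹ * Y) * B * Y⁻¹ := by simp only [mul_assoc]
      _ = _ := by rw [hinv, mul_one]; simp only [mul_assoc]
  let X₀ : Matrix χ χ ℂ := (pauliX ⊗ₖ (1 : Matrix (Fin D') (Fin D') ℂ)).submatrix e e
  have hXX : pauliX * pauliX = 1 := by
    simp [pauliX, Matrix.one_fin_two]
  have hXZ : pauliX * pauliZ = -(pauliZ * pauliX) := by
    simp [pauliX, pauliZ]
  have hX₀Z : X₀ * parityOp q = -(parityOp q * X₀) := by
    rw [hZ, Matrix.submatrix_mul_equiv, Matrix.submatrix_mul_equiv, ← Matrix.mul_kronecker_mul,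
      ← Matrix.mul_kronecker_mul, hXZ]
    ext a b
    simp [Matrix.kroneckerMap_apply]
  refine ⟨Y * X₀ * Y⁻¹, ?_, ?_, fun n m => ?_⟩
  · rw [hconj, Matrix.submatrix_mul_equiv, ← Matrix.mul_kronecker_mul, hXX, one_mul,
      Matrix.one_kronecker_one, Matrix.submatrix_one_equiv, mul_one, hinv']
  · rw [mul_assoc, ← hZY', mul_assoc, ← mul_assoc X₀, hX₀Z, ← mul_assoc (parityOp q),
      ← mul_assoc (parityOp q), hZY]
    simp only [mul_assoc, neg_mul, mul_neg]
  · rw [hUM, hconj, hconj, Matrix.submatrix_mul_equiv, Matrix.submatrix_mul_equiv,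
      ← Matrix.mul_kronecker_mul, ← Matrix.mul_kronecker_mul, one_mul, mul_one,
      ← pow_succ, ← pow_succ']

omit [DecidableEq ι] in
lemma one_kronecker_mul_stacked {X : Matrix χ χ ℂ} (hXU : ∀ n m, X * U n m = U n m * X)
    (k i : ι) :
    ((1 : Matrix χ χ ℂ) ⊗ₖ X) * stacked p q U k i =
      stacked p q U k i * ((1 : Matrix χ χ ℂ) ⊗ₖ X) := by
  rw [stacked_eq_sum, Finset.mul_sum, Finset.sum_mul]
  refine Finset.sum_congr rfl fun j _ => ?_
  rw [← Matrix.mul_kronecker_mul, ← Matrix.mul_kronecker_mul, one_mul, mul_one, hXU]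

-- The signs are $|j|+|k|$ and $|j|+|i|$ from the parity operators on the two legs, and $|k|+|i|$
-- from moving $\overline X$ past the parity factor. They sum to zero.
omit [DecidableEq ι] in
lemma oddSymmetry_kronecker_mul_stacked (hU : IsEven p q U) {X : Matrix χ χ ℂ}
    (hXZ : X * parityOp q = -(parityOp q * X)) (hXU : ∀ n m, X * U n m = U n m * X) (k i : ι) :
    ((parityOp q * X.map star) ⊗ₖ parityOp q) * stacked p q U k i =
      stacked p q U k i * ((parityOp q * X.map star) ⊗ₖ parityOp q) := by
  have hstar : ∀ {A B : Matrix χ χ ℂ}, A = B → A.map star = B.map star := fun h => by rw [h]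
  have h1 : ∀ j, X.map star * (U j k).map star = (U j k).map star * X.map star := fun j => by
    rw [← map_star_mul, hXU, map_star_mul]
  have h2 : ∀ j, parityOp q * (U j k).map star =
      sgn (p j + p k) • ((U j k).map star * parityOp q) := fun j => by
    have := hU.parityPow_mul j k 1
    rwa [parityPow_one, one_mul] at this
  have h3 : parityOp q * X = sgn 1 • (X * parityOp q) := by
    rw [hXZ, sgn_one, neg_smul, one_smul, neg_neg]
  have h3' : parityOp q * X.map star = sgn 1 • (X.map star * parityOp q) := by
    have := hstar h3
    rwa [map_star_smul, map_star_mul, map_star_mul, map_star_parityOp, star_sgn] at this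
  have h4 : ∀ σ, X.map star * parityPow q σ = sgn σ • (parityPow q σ * X.map star) := fun σ => by
    rw [parityPow_mul_of_parityOp_mul q h3', mul_one, smul_smul, sgn_mul_self, one_smul]
  have h5 : ∀ σ, parityOp q * parityPow q σ = parityPow q σ * parityOp q := fun σ => by
    rw [← parityPow_one, ← parityPow_add, ← parityPow_add, add_comm]
  rw [stacked_eq_sum, Finset.mul_sum, Finset.sum_mul]
  refine Finset.sum_congr rfl fun j _ => ?_
  rw [← Matrix.mul_kronecker_mul, ← Matrix.mul_kronecker_mul, hU j i]
  have h6 : parityOp q * X.map star * ((U j k).map star * parityPow q (p k + p i)) =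
      sgn (p j + p i) • ((U j k).map star * parityPow q (p k + p i) *
        (parityOp q * X.map star)) := by
    calc _ = parityOp q * (X.map star * (U j k).map star) * parityPow q (p k + p i) := by
          simp only [mul_assoc]
      _ = parityOp q * (U j k).map star * (X.map star * parityPow q (p k + p i)) := by
          rw [h1]; simp only [mul_assoc]
      _ = sgn ((p j + p k) + (p k + p i)) • ((U j k).map star *
            (parityOp q * parityPow q (p k + p i)) * X.map star) := by
          rw [h2, h4, Matrix.smul_mul, Matrix.mul_smul, smul_smul, ← sgn_add]
          simp only [mul_assoc]
      _ = _ := by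
          rw [h5, show (p j + p k) + (p k + p i) = p j + p i by
            linear_combination CharTwo.add_self_eq_zero (p k)]
          simp only [mul_assoc]
  rw [h6, Matrix.smul_kronecker, Matrix.kronecker_smul, smul_smul, sgn_mul_self, one_smul]

-- Conjugation by $V=Z\overline X\otimes Z$, with $V^2=-1$, fixes the word and flips $1\otimes X$,
-- so the trace equals its negative.
omit [DecidableEq ι] in
lemma trace_one_kronecker_mul_prod_stacked (hU : IsEven p q U) {X : Matrix χ χ ℂ}
    (hX : X * X = 1) (hXZ : X * parityOp q = -(parityOp q * X))
    (hXU : ∀ n m, X * U n m = U n m * X) {N : ℕ} (k i : Fin N → ι) :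
    (((1 : Matrix χ χ ℂ) ⊗ₖ X) *
      (List.ofFn fun j => stacked p q U (k j) (i j)).prod).trace = 0 := by
  have hcomm := mul_prod_ofFn (fun j => stacked p q U (k j) (i j)) fun a =>
    oddSymmetry_kronecker_mul_stacked (p := p) hU hXZ hXU (k a) (i a)
  set W := (List.ofFn fun j => stacked p q U (k j) (i j)).prod
  have hXs : X.map star * X.map star = 1 := by
    rw [← map_star_mul, hX, Matrix.map_one _ (star_zero ℂ) (star_one ℂ)]
  have hXZs : X.map star * parityOp q = -(parityOp q * X.map star) := by
    rw [← neg_one_smul ℂ, ← sgn_one] at hXZ ⊢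
    have := congrArg (fun A : Matrix χ χ ℂ => A.map star) hXZ
    simpa only [map_star_smul, map_star_mul, map_star_parityOp, star_sgn] using this
  have hV2 : ((parityOp q * X.map star) ⊗ₖ parityOp q) *
      ((parityOp q * X.map star) ⊗ₖ parityOp q) = -1 := by
    rw [← Matrix.mul_kronecker_mul, parityOp_mul_self, mul_assoc, ← mul_assoc (X.map star), hXZs,
      neg_mul, mul_assoc, hXs, mul_one, mul_neg, parityOp_mul_self]
    rw [← neg_one_smul ℂ (1 : Matrix χ χ ℂ), Matrix.smul_kronecker, Matrix.one_kronecker_one,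
      neg_one_smul]
  have hVT : ((parityOp q * X.map star) ⊗ₖ parityOp q) * ((1 : Matrix χ χ ℂ) ⊗ₖ X) =
      -(((1 : Matrix χ χ ℂ) ⊗ₖ X) * ((parityOp q * X.map star) ⊗ₖ parityOp q)) := by
    rw [← Matrix.mul_kronecker_mul, ← Matrix.mul_kronecker_mul, hXZ, one_mul, mul_one]
    ext a b
    simp [Matrix.kroneckerMap_apply]
  generalize (parityOp q * X.map star) ⊗ₖ parityOp q = V at hcomm hV2 hVT
  generalize (1 : Matrix χ χ ℂ) ⊗ₖ X = T at hVT
  have h1 : (T * W).trace = -(T * W).trace :=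
    calc (T * W).trace = -(V * V * (T * W)).trace := by
          rw [hV2, neg_one_mul, Matrix.trace_neg, neg_neg]
      _ = -(V * (T * W) * V).trace := by rw [mul_assoc, Matrix.trace_mul_comm]
      _ = (T * W * (V * V)).trace := by
        rw [← mul_assoc V, hVT, neg_mul, neg_mul, Matrix.trace_neg, neg_neg, mul_assoc T, hcomm]
        simp only [mul_assoc]
      _ = _ := by rw [hV2, mul_neg_one, Matrix.trace_neg]
  exact self_eq_neg.1 h1

lemma isWordSimple_stacked_of_odd_symmetry [Nonempty ι] {c : ℂ} (hc : star c * c = 1 / 2)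
    (h : GeneratesAPUnitary p q (c • (1 : Matrix χ χ ℂ)) U) {X : Matrix χ χ ℂ}
    (hX : X * X = 1) (hXZ : X * parityOp q = -(parityOp q * X))
    (hXU : ∀ n m, X * U n m = U n m * X) {n : ℕ}
    (hn : Fintype.card (χ × χ) ≤ n) (hn1 : 1 ≤ n) :
    IsWordSimple (fun x : ι × ι => stacked p q U x.1 x.2) diagWeight transferCoeff n := by
  -- Words have trace twice the weight; the projection halves it, its `X` term contributing nothing.
  have key : ∀ ε : ℂ, ε * ε = 1 → IsWordSimple
      (fun x : ι × ι => ((1 / 2 : ℂ) • (1 + ε • ((1 : Matrix χ χ ℂ) ⊗ₖ X))) *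
        stacked p q U x.1 x.2) diagWeight transferCoeff n := by
    intro ε hε
    refine isWordSimple_of_trace hn hn1 sum_transferCoeff_mul fun N hN x => ?_
    rw [prod_ofFn_mul hN, smul_mul_assoc, add_mul, one_mul, smul_mul_assoc, Matrix.trace_smul,
      Matrix.trace_add, Matrix.trace_smul,
      trace_one_kronecker_mul_prod_stacked h.1 hX hXZ hXU (fun a => (x a).1) fun a => (x a).2,
      smul_zero, add_zero, prod_diagWeight, ← trace_prod_stacked h hN, hc, smul_eq_mul]
    · have hT : ((1 : Matrix χ χ ℂ) ⊗ₖ X) * ((1 : Matrix χ χ ℂ) ⊗ₖ X) = 1 := by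
        rw [← Matrix.mul_kronecker_mul, hX, one_mul, Matrix.one_kronecker_one]
      rw [smul_mul_smul_comm, add_mul, one_mul, mul_add, mul_one, smul_mul_smul_comm, hT, hε]
      module
    · intro a
      rw [smul_mul_assoc, mul_smul_comm, add_mul, mul_add, smul_mul_assoc, mul_smul_comm,
        one_kronecker_mul_stacked hXU, one_mul, mul_one]
  have h1 := key 1 (one_mul 1)
  have h2 := key (-1) (by norm_num)
  refine IsWordSimple.of_add hn1 ?_ ?_ h1 ?_
  · have hT : ((1 : Matrix χ χ ℂ) ⊗ₖ X) * ((1 : Matrix χ χ ℂ) ⊗ₖ X) = 1 := by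
      rw [← Matrix.mul_kronecker_mul, hX, one_mul, Matrix.one_kronecker_one]
    rw [smul_mul_smul_comm, one_smul, add_mul, one_mul, mul_add, mul_one, hT]
    module
  · intro x
    rw [smul_mul_assoc, mul_smul_comm, add_mul, mul_add, smul_mul_assoc, mul_smul_comm,
      one_kronecker_mul_stacked hXU, one_mul, mul_one]
  · have : (1 : Matrix (χ × χ) (χ × χ) ℂ) - (1 / 2 : ℂ) • (1 + (1 : ℂ) • ((1 : Matrix χ χ ℂ) ⊗ₖ X))
        = (1 / 2 : ℂ) • (1 + (-1 : ℂ) • ((1 : Matrix χ χ ℂ) ⊗ₖ X)) := by module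
    rwa [this]

lemma GeneratesAPUnitary.nonempty [Nonempty ι] {S : Matrix χ χ ℂ}
    (h : GeneratesAPUnitary p q S U) : Nonempty χ := by
  by_contra hχ
  rw [not_nonempty_iff] at hχ
  have h1 := Matrix.mem_unitaryGroup_iff.1 (h.2.2.2 1 le_rfl)
  obtain ⟨s⟩ : Nonempty (Fin 1 → ι) := inferInstance
  have h2 := congrFun (congrFun h1 s) s
  simp [Matrix.mul_apply, chainOp_apply, Matrix.trace] at h2

end Simpleness

end FermionicMPU
end

/-! ### The proposition -/

theorem mainTheorem7 {d D : ℕ} (hd : 1 ≤ d) (p : Fin d → ZMod 2) (q : Fin D → ZMod 2)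
    (U : Fin d → Fin d → Matrix (Fin D) (Fin D) ℂ)
    (hU : FermionicMPU.GeneratesTypeI p q U ∨ FermionicMPU.GeneratesTypeII p q U) :
    ∃ k : ℕ, 1 ≤ k ∧ k ≤ D ^ 4 ∧
      FermionicMPU.IsSimple (FermionicMPU.blockParity p k) q
        (FermionicMPU.blockTensor p U k) := by
  have : Nonempty (Fin d) := ⟨⟨0, hd⟩⟩
  have hexp : ∀ α : ℝ, star (Complex.exp (α * Complex.I)) * Complex.exp (α * Complex.I) = 1 := by
    intro α
    rw [Complex.star_def, ← Complex.normSq_eq_conj_mul_self, Complex.normSq_eq_norm_sq,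
      Complex.norm_exp_ofReal_mul_I]
    norm_num
  have hD : 1 ≤ D := by
    have : Nonempty (Fin D) := by
      rcases hU with ⟨α, h⟩ | ⟨-, α, h⟩ <;> exact h.nonempty
    exact Fin.pos_iff_nonempty.2 this
  have h1 : 1 ≤ D ^ 2 := Nat.one_le_pow _ _ hD
  have hcard : Fintype.card (Fin D × Fin D) ≤ D ^ 2 := by simp [sq]
  -- `D ^ 2` is the dimension of the doubled auxiliary space, the length at which products in the
  -- trace kernel vanish.
  refine ⟨D ^ 2, h1, Nat.pow_le_pow_right hD (by norm_num), ?_⟩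
  rcases hU with ⟨α, h⟩ | ⟨hII, α, h⟩
  · exact FermionicMPU.isSimple_blockTensor h.1
      (FermionicMPU.isWordSimple_stacked_of_unit_boundary (hexp α) h hcard h1)
  · obtain ⟨X, hX, hXZ, hXU⟩ := hII.exists_odd_symmetry
    refine FermionicMPU.isSimple_blockTensor h.1
      (FermionicMPU.isWordSimple_stacked_of_odd_symmetry ?_ h hX hXZ hXU hcard h1)
    have h2 : (Real.sqrt 2 : ℂ) * (Real.sqrt 2 : ℂ) = 2 := by
      rw [← Complex.ofReal_mul, Real.mul_self_sqrt (by norm_num)]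
      norm_num
    rw [star_div₀, div_mul_div_comm, hexp, Complex.star_def, Complex.conj_ofReal, h2]
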